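/- Let $q\ge 3$ and $p\ge 2q-1$ be integers, and put $r=\lceil p/(q-1)\rceil$. For a graph $F$ let $\mathrm{ex}(n,F)$ be the maximum number of edges of a graph on $n$ vertices with no subgraph isomorphic to $F$, and let ${\uparrow}F$ be the family of all finite graphs that contain $F$ as a (not necessarily induced) subgraph. For a graph $G$ and a family $\mathcal F$ of graphs with $K_2\notin\mathcal F$, let $g(n,G\,|\,\mathcal F)$ be the largest integer $m$ for which there is an edge coloring of the complete graph $K_n$ with exactly $m$ colors such that every copy of $G$ in $K_n$ contains a color class (the graph formed by all edges of one color in that copy and their end vertices) which is a member of $\mathcal F$; if there is no such coloring, then $g(n,G\,|\,\mathcal F)=0$. Then, for every connected graph $H$ of order $q$, $$\mathrm{ex}(n,K_r)+r-1\;\le\; g(n,K_p\,|\,{\uparrow}K_q)\;\le\; g(n,K_p\,|\,{\uparrow}H)\;\le\;(1+o(1))\,\mathrm{ex}(n,K_r),$$ where all inequalities hold for every $n\ge p$, and $o(1)\to 0$ as $n\to\infty$ with $p$, $q$, $H$ fixed. In particular, for the path $P_q$ and the cycle $C_q$ on $q$ vertices, as $n\to\infty$, $$g(n,K_p\,|\,{\uparrow}P_q)=(1+o(1))\,\mathrm{ex}(n,K_r)\qquad\text{and}\qquad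 g(n,K_p\,|\,{\uparrow}C_q)=(1+o(1))\,\mathrm{ex}(n,K_r).$$ -/

import Mathlib

/-- A family of finite graphs: a property of finite graphs that is invariant under isomorphism. -/
structure GraphFamily where
  Mem : ∀ {V : Type} [Finite V], SimpleGraph V → Prop
  iso_closed : ∀ {V W : Type} [Finite V] [Finite W] (A : SimpleGraph V) (B : SimpleGraph W),
    Nonempty (A ≃g B) → Mem A → Mem B

/-- The family of all finite graphs that contain `H` as a (not necessarily induced) subgraph. -/
def upFamily {W : Type*} (H : SimpleGraph W) : GraphFamily where
  Mem := fun A => H.IsContained A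
  iso_closed := fun _ _ e h => h.trans ⟨e.some.toCopy⟩

/-- The edges of the copy `K` that have color `c` in the edge coloring `C` of the complete graph
on `Fin n`, as a graph on the whole vertex set `Fin n`. -/
def colorPart {n : ℕ} {κ : Type} (C : SimpleGraph.TopEdgeLabeling (Fin n) κ)
    (K : (⊤ : SimpleGraph (Fin n)).Subgraph) (c : κ) : SimpleGraph (Fin n) :=
  K.spanningCoe ⊓ C.labelGraph c

/-- The color class of color `c` inside `K`, as the graph formed by the edges of `K` of color `c`
and their end vertices (hence without isolated vertices). -/
def colorClass {n : ℕ} {κ : Type} (C : SimpleGraph.TopEdgeLabeling (Fin n) κ)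
    (K : (⊤ : SimpleGraph (Fin n)).Subgraph) (c : κ) : SimpleGraph (colorPart C K c).support :=
  (colorPart C K c).induce (colorPart C K c).support

/-- In the edge coloring `C` of the complete graph on `Fin n`, every copy of `G` contains a
(nonempty) color class that is a member of the family `F`. -/
def Pierces {n : ℕ} {κ : Type} {W : Type*} (C : SimpleGraph.TopEdgeLabeling (Fin n) κ)
    (G : SimpleGraph W) (F : GraphFamily) : Prop :=
  ∀ K : (⊤ : SimpleGraph (Fin n)).Subgraph, Nonempty (G ≃g K.coe) →
    ∃ c : κ, colorPart C K c ≠ ⊥ ∧ F.Mem (colorClass C K c)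

/-- The numbers `m` for which some edge coloring of the complete graph on `Fin n` with exactly `m`
colors has in every copy of `G` a color class that is a member of `F`. -/
def piercingCounts (n : ℕ) {W : Type*} (G : SimpleGraph W) (F : GraphFamily) : Set ℕ :=
  {m | ∃ C : SimpleGraph.TopEdgeLabeling (Fin n) (Fin m), Function.Surjective C ∧ Pierces C G F}

theorem bddAbove_piercingCounts (n : ℕ) {W : Type*} (G : SimpleGraph W) (F : GraphFamily) :
    BddAbove (piercingCounts n G F) := by
  refine ⟨Nat.card (⊤ : SimpleGraph (Fin n)).edgeSet, ?_⟩
  rintro m ⟨C, hC, -⟩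
  have h := Nat.card_le_card_of_surjective _ hC
  rwa [Nat.card_fin] at h

/-- The piercing number `g(n, G | F)`: the largest element of `piercingCounts n G F`, and `0` if
there is none (the set is bounded above by `bddAbove_piercingCounts`). -/
noncomputable def piercingNumber (n : ℕ) {W : Type*} (G : SimpleGraph W) (F : GraphFamily) : ℕ :=
  sSup (piercingCounts n G F)

/-! Write `s = r - 1`. For the lower bound, make the Turán graph rainbow and give each of its `s`
parts one extra color. Since `s * (q - 1) < p`, any `p` vertices include `q` in one part, hence a
monochromatic `K_q`.

For the upper bound, keep one edge of each color, giving a rainbow graph `R`. If `R` has more edges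
than the extremal number of a complete `r`-partite graph with large constant parts, it contains that
graph. Cut each part into `P` blocks of size `q - 1`, and pick one block per part so that no color
inside a picked block appears between two picked blocks (`exists_choice_avoiding`). The picked
blocks hold `r * (q - 1) ≥ p` vertices. A monochromatic connected `H` of order `q` does not fit in
one block, so it uses an edge between blocks; that color occurs on no other edge there, yet `H` has
at least two edges.

By Erdős-Stone, the two extremal numbers agree asymptotically. -/

/-! ### Choosing one block in each part -/

/-- Affine maps over `ZMod P` give a choice function avoiding few forbidden pairs. -/
theorem exists_choice_avoiding {r P : ℕ} {Δ : Type*} [Fintype Δ] [hP : Fact P.Prime]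
    (hr : r ≤ P) (hP' : r * Fintype.card Δ < P)
    (bad : Fin r → ZMod P → Δ → Fin r × ZMod P) :
    ∃ k : Fin r → ZMod P, ∀ i δ j, j ≠ i → bad i (k i) δ ≠ (j, k j) := by
  by_contra! h
  -- A conflict between `(i, k)` and its forbidden pair determines the line through both points. If
  -- every line had a conflict, `Φ` would be onto all `P ^ 2` lines, but there are only `r * P *
  -- |Δ|` possible conflicts.
  let Φ : Fin r × ZMod P × Δ → ZMod P × ZMod P := fun x =>
    let y := bad x.1 x.2.1 x.2.2
    let b := (y.2 - x.2.1) / ((y.1 : ℕ) - (x.1 : ℕ) : ZMod P)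
    (x.2.1 - b * (x.1 : ℕ), b)
  have hsurj : Function.Surjective Φ := by
    rintro ⟨a, b⟩
    obtain ⟨i, δ, j, hij, hb⟩ := h fun i => a + b * (i : ℕ)
    refine ⟨(i, a + b * (i : ℕ), δ), ?_⟩
    have hne : ((j : ℕ) - (i : ℕ) : ZMod P) ≠ 0 := by
      rw [sub_ne_zero]
      intro e
      have := (ZMod.natCast_eq_natCast_iff' _ _ _).1 e
      rw [Nat.mod_eq_of_lt (j.2.trans_le hr), Nat.mod_eq_of_lt (i.2.trans_le hr)] at this
      exact hij (Fin.ext this)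
    have hbb : (a + b * (j : ℕ) - (a + b * (i : ℕ))) / ((j : ℕ) - (i : ℕ) : ZMod P) = b := by
      rw [div_eq_iff hne]; ring
    simp only [Φ, hb, hbb, Prod.mk.injEq, and_true]
    ring
  have hc := Fintype.card_le_of_surjective Φ hsurj
  simp only [Fintype.card_prod, Fintype.card_fin, ZMod.card] at hc
  have := hP.out.pos
  nlinarith

/-! ### Connected graphs and the Erdős-Stone bound -/

namespace SimpleGraph

theorem Connected.exists_adj_ne {V α : Type*} {H : SimpleGraph V} (hH : H.Connected)
    (f : V → α) {u v : V} (huv : f u ≠ f v) : ∃ x y, H.Adj x y ∧ f x ≠ f y := by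
  obtain ⟨w⟩ := hH.preconnected u v
  obtain ⟨d, -, h1, h2⟩ := w.exists_boundary_dart {x | f x = f u} rfl fun h => huv h.symm
  exact ⟨d.fst, d.snd, d.adj, fun e => h2 (e.symm.trans h1)⟩

/-- In a connected graph on at least three vertices, every edge meets another edge. -/
theorem Connected.exists_adj_edge_ne {V : Type*} [Fintype V] {H : SimpleGraph V}
    (hH : H.Connected) (hV : 3 ≤ Fintype.card V) (u v : V) :
    ∃ x y, H.Adj x y ∧ (x = u ∨ x = v) ∧ y ≠ u ∧ y ≠ v := by
  classical
  obtain ⟨w, hw⟩ : ∃ w, w ∉ ({u, v} : Finset V) := by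
    by_contra! h
    have h1 := Finset.card_le_card (fun x _ => h x : (Finset.univ : Finset V) ⊆ {u, v})
    have h2 := Finset.card_le_two (a := u) (b := v)
    rw [Finset.card_univ] at h1
    omega
  obtain ⟨p⟩ := hH.preconnected u w
  obtain ⟨d, -, h1, h2⟩ := p.exists_boundary_dart {x | x = u ∨ x = v} (Or.inl rfl)
    (by simpa using hw)
  simp only [Set.mem_ofPred_eq, not_or] at h1 h2
  exact ⟨d.fst, d.snd, d.adj, h1, h2⟩

/-- Delete a vertex of minimum degree from an extremal graph; this turns minimum-degree results into
edge counts by induction. -/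
theorem extremalNumber_succ_le {W : Type*} {H : SimpleGraph W} (hH : H ≠ ⊥) (n : ℕ) :
    ∃ (G : SimpleGraph (Fin (n + 1))) (_ : DecidableRel G.Adj), H.Free G ∧
      extremalNumber (n + 1) H ≤ extremalNumber n H + G.minDegree := by
  classical
  obtain ⟨G, hd, hG⟩ := exists_isExtremal_free (V := Fin (n + 1)) hH
  obtain ⟨hfree, hcard⟩ := isExtremal_free_iff.1 hG
  refine ⟨G, hd, hfree, ?_⟩
  obtain ⟨v, hv⟩ := G.exists_minimal_degree_vertex
  have h1 := card_edgeFinset_deleteIncidenceSet_le_extremalNumber hfree v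
  rw [card_edgeFinset_deleteIncidenceSet] at h1
  simp only [Fintype.card_fin, Nat.add_sub_cancel] at h1 hcard
  omega

/-- An asymptotic form of the Erdős-Stone theorem, for the extremal number. -/
theorem exists_extremalNumber_completeEquipartiteGraph_le {ε : ℝ} (hε : 0 < ε) {s t : ℕ}
    (hs : 1 ≤ s) (ht : 1 ≤ t) :
    ∃ C : ℝ, ∀ n : ℕ, (extremalNumber n (completeEquipartiteGraph (s + 1) t) : ℝ) ≤
      C + (1 - 1 / s + ε) * (n * (n + 1) / 2) := by
  have hne : completeEquipartiteGraph (s + 1) t ≠ ⊥ := by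
    rw [Ne, completeEquipartiteGraph_eq_bot_iff]
    omega
  obtain ⟨N, hN⟩ := Filter.eventually_atTop.1
    (eventually_completeEquipartiteGraph_isContained_of_minDegree hε s t)
  have hα : 0 ≤ 1 - 1 / (s : ℝ) + ε := by
    have : 1 / (s : ℝ) ≤ 1 := by
      rw [div_le_one (by positivity)]
      exact_mod_cast hs
    linarith
  -- The constant covers every `n ≤ N`, where the minimum-degree theorem is unavailable. Past `N`,
  -- the step to `n + 1` adds at most `(1 - 1 / s + ε) * (n + 1)`.
  refine ⟨∑ i ∈ Finset.range (N + 1),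
    (extremalNumber i (completeEquipartiteGraph (s + 1) t) : ℝ), fun n => ?_⟩
  induction n with
  | zero =>
    simp only [Nat.cast_zero, zero_mul, zero_div, mul_zero, add_zero]
    exact Finset.single_le_sum
      (f := fun i => (extremalNumber i (completeEquipartiteGraph (s + 1) t) : ℝ))
      (fun i _ => Nat.cast_nonneg _) (by simp)
  | succ n ih =>
    rcases le_or_gt (n + 1) N with h | h
    · refine (Finset.single_le_sum
        (f := fun i => (extremalNumber i (completeEquipartiteGraph (s + 1) t) : ℝ))
        (fun i _ => Nat.cast_nonneg _) (Finset.mem_range.2 (by omega : n + 1 < N + 1))).trans ?_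
      exact le_add_of_nonneg_right (by positivity)
    · obtain ⟨G, hd, hfree, hle⟩ := extremalNumber_succ_le hne n
      have hmin : (G.minDegree : ℝ) ≤ (1 - 1 / s + ε) * ((n + 1 : ℕ) : ℝ) := by
        by_contra! hlt
        exact hfree (hN (n + 1) h.le hlt.le)
      have hle' : (extremalNumber (n + 1) (completeEquipartiteGraph (s + 1) t) : ℝ) ≤
          extremalNumber n (completeEquipartiteGraph (s + 1) t) + G.minDegree := by
        exact_mod_cast hle
      push_cast at hmin ⊢
      nlinarith

/-- In the exact Turán count, the floor costs at most `1` and the residue `n % s` at most `s ^ 2`;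
the binomial term is dropped. -/
theorem le_extremalNumber_top {s : ℕ} (hs : 1 ≤ s) (n : ℕ) :
    (1 - 1 / (s : ℝ)) * (n ^ 2 / 2) - (s ^ 2 + 1) ≤
      extremalNumber n (⊤ : SimpleGraph (Fin (s + 1))) := by
  have : Nontrivial (Fin (s + 1)) := Fin.nontrivial_iff_two_le.2 (by omega)
  rw [extremalNumber_top, Fintype.card_fin, Nat.add_sub_cancel, card_edgeFinset_turanGraph]
  have hs' : (1 : ℝ) ≤ s := by exact_mod_cast hs
  have hmod : ((n % s : ℕ) : ℝ) ≤ s := by exact_mod_cast (Nat.mod_lt n hs).le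
  have hmod0 : (0 : ℝ) ≤ ((n % s : ℕ) : ℝ) := Nat.cast_nonneg _
  have hsub : (((n ^ 2 - (n % s) ^ 2) * (s - 1) : ℕ) : ℝ) =
      ((n : ℝ) ^ 2 - ((n % s : ℕ) : ℝ) ^ 2) * (s - 1) := by
    rw [Nat.cast_mul, Nat.cast_sub (Nat.pow_le_pow_left (Nat.mod_le _ _) 2), Nat.cast_sub hs]
    push_cast
    ring
  have hdiv := Nat.lt_div_mul_add (a := (n ^ 2 - (n % s) ^ 2) * (s - 1)) (b := 2 * s) (by omega)
  have hdiv' : ((n : ℝ) ^ 2 - ((n % s : ℕ) : ℝ) ^ 2) * (s - 1) ≤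
      (((n ^ 2 - (n % s) ^ 2) * (s - 1) / (2 * s) : ℕ) : ℝ) * (2 * s) + 2 * s := by
    rw [← hsub]
    exact_mod_cast hdiv.le
  have hch : (0 : ℝ) ≤ ((n % s).choose 2 : ℝ) := Nat.cast_nonneg _
  rw [Nat.cast_add]
  set A : ℝ := (((n ^ 2 - (n % s) ^ 2) * (s - 1) / (2 * s) : ℕ) : ℝ)
  have h1 : ((n : ℝ) ^ 2 - ((n % s : ℕ) : ℝ) ^ 2) * (s - 1) / (2 * s) ≤ A + 1 := by
    rw [div_le_iff₀ (by positivity)]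
    linarith
  have h2 : ((n : ℝ) ^ 2 - ((n % s : ℕ) : ℝ) ^ 2) * (s - 1) / (2 * s) =
      (1 - 1 / (s : ℝ)) * (n ^ 2 / 2) - (1 - 1 / (s : ℝ)) * (((n % s : ℕ) : ℝ) ^ 2 / 2) := by
    field_simp
  have h3 : (1 - 1 / (s : ℝ)) * (((n % s : ℕ) : ℝ) ^ 2 / 2) ≤ s ^ 2 := by
    have : 0 ≤ 1 / (s : ℝ) := by positivity
    have : ((n % s : ℕ) : ℝ) ^ 2 ≤ (s : ℝ) ^ 2 := by gcongr
    nlinarith [sq_nonneg ((n % s : ℕ) : ℝ)]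
  linarith

/-- The extremal number of a complete equipartite graph is at most asymptotically the Turán
number. -/
theorem eventually_extremalNumber_completeEquipartiteGraph_le {η : ℝ} (hη : 0 < η) {s t : ℕ}
    (hs : 2 ≤ s) (ht : 1 ≤ t) :
    ∀ᶠ n : ℕ in Filter.atTop,
      (extremalNumber n (completeEquipartiteGraph (s + 1) t) : ℝ) ≤
        (1 + η) * extremalNumber n (⊤ : SimpleGraph (Fin (s + 1))) := by
  have hs' : (2 : ℝ) ≤ s := by exact_mod_cast hs
  -- As `1 - 1 / s ≥ 1 / 2`, the factor `1 + η` gains at least `η * n ^ 2 / 4`. The choice `ε = η /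
  -- 4` spends half of it, and the other half absorbs all linear and constant terms.
  obtain ⟨C, hC⟩ := exists_extremalNumber_completeEquipartiteGraph_le
    (ε := η / 4) (by positivity) (by omega : 1 ≤ s) ht
  have hlin : Filter.Tendsto (fun n : ℕ => (η / 8) * (n : ℝ)) Filter.atTop Filter.atTop :=
    tendsto_natCast_atTop_atTop.const_mul_atTop (by positivity)
  filter_upwards [hlin.eventually_ge_atTop (|C| + (1 + η) * (s ^ 2 + 1) + 1 + η / 8),
    Filter.eventually_ge_atTop 1] with n hn hn1
  have h1 := hC n
  have h2 := le_extremalNumber_top (by omega : 1 ≤ s) n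
  have hn1' : (1 : ℝ) ≤ n := by exact_mod_cast hn1
  have hα : 1 / 2 ≤ 1 - 1 / (s : ℝ) := by
    have : 1 / (s : ℝ) ≤ 1 / 2 := by gcongr
    linarith
  have hα1 : 1 - 1 / (s : ℝ) ≤ 1 := by
    have : 0 ≤ 1 / (s : ℝ) := by positivity
    linarith
  set α := 1 - 1 / (s : ℝ)
  set K : ℝ := s ^ 2 + 1
  have hK : 0 ≤ K := by positivity
  refine h1.trans (le_trans ?_ (mul_le_mul_of_nonneg_left h2 (by positivity)))
  have hCa := le_abs_self C
  have h3 : η * (1 / 2) * (n ^ 2 / 2) ≤ η * α * (n ^ 2 / 2) := by gcongr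
  have h4 : α * (n / 2) ≤ 1 * (n / 2) := by gcongr
  have h5 : (|C| + (1 + η) * K + 1 + η / 8) * n ≤ η / 8 * n * n := by gcongr
  have h6 : (|C| + (1 + η) * K) * 1 ≤ (|C| + (1 + η) * K) * n := by gcongr
  nlinarith

end SimpleGraph

/-! ### Basic properties of the piercing number -/

theorem le_piercingNumber {n m : ℕ} {W : Type*} {G : SimpleGraph W} {F : GraphFamily}
    (h : m ∈ piercingCounts n G F) : m ≤ piercingNumber n G F :=
  le_csSup (bddAbove_piercingCounts n G F) h

theorem piercingNumber_le {n m : ℕ} {W : Type*} {G : SimpleGraph W} {F : GraphFamily}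
    (h : ∀ k ∈ piercingCounts n G F, k ≤ m) : piercingNumber n G F ≤ m := by
  rcases (piercingCounts n G F).eq_empty_or_nonempty with h0 | h0
  · simp [piercingNumber, h0]
  · exact csSup_le h0 h

theorem piercingNumber_mono {n : ℕ} {W V₁ V₂ : Type*} (G : SimpleGraph W) {H₁ : SimpleGraph V₁}
    {H₂ : SimpleGraph V₂} (h : H₂.IsContained H₁) :
    piercingNumber n G (upFamily H₁) ≤ piercingNumber n G (upFamily H₂) := by
  refine piercingNumber_le fun k ⟨C, hC, hp⟩ => le_piercingNumber ⟨C, hC, fun K hK => ?_⟩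
  obtain ⟨c, hc, hm⟩ := hp K hK
  exact ⟨c, hc, h.trans hm⟩

-- Colors may be renamed, so a construction can use its natural index type.
open SimpleGraph in
theorem mem_piercingCounts_of_surjective {n m : ℕ} {κ W : Type} {G : SimpleGraph W}
    {F : GraphFamily} (e : κ ≃ Fin m) (C : TopEdgeLabeling (Fin n) κ)
    (hC : Function.Surjective C) (hp : Pierces C G F) : m ∈ piercingCounts n G F := by
  refine ⟨C.compRight e, e.surjective.comp hC, fun K hK => ?_⟩
  obtain ⟨c, hc, hm⟩ := hp K hK
  have : colorPart (C.compRight e) K (e c) = colorPart C K c := by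
    ext u v
    simp [colorPart]
  refine ⟨e c, by rwa [this], F.iso_closed _ _ ⟨?_⟩ hm⟩
  unfold colorClass
  rw [this]

/-- A clique contained in a color part gives a clique in the color class. -/
theorem top_isContained_colorClass {n q : ℕ} {κ : Type} (hq : 2 ≤ q)
    (C : SimpleGraph.TopEdgeLabeling (Fin n) κ) (K : (⊤ : SimpleGraph (Fin n)).Subgraph) (c : κ)
    (h : (⊤ : SimpleGraph (Fin q)).IsContained (colorPart C K c)) :
    colorPart C K c ≠ ⊥ ∧ (⊤ : SimpleGraph (Fin q)).IsContained (colorClass C K c) := by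
  obtain ⟨f⟩ := h
  have : Nontrivial (Fin q) := Fin.nontrivial_iff_two_le.2 hq
  have hadj : ∀ i j, i ≠ j → (colorPart C K c).Adj (f i) (f j) := fun i j hij =>
    f.toHom.map_adj (by simpa using hij)
  have hs : ∀ i, f i ∈ (colorPart C K c).support := fun i => by
    obtain ⟨j, hj⟩ := exists_ne i
    exact ⟨f j, hadj i j hj.symm⟩
  constructor
  · intro h0
    obtain ⟨i, j, hij⟩ := exists_pair_ne (Fin q)
    exact SimpleGraph.eq_bot_iff_forall_not_adj.1 h0 _ _ (hadj i j hij)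
  · exact ⟨⟨⟨fun i => ⟨f i, hs i⟩, fun {i j} hij => hadj i j (by simpa using hij)⟩,
      fun i j hij => f.injective (congrArg Subtype.val hij)⟩⟩

/-! ### Lower bound: the Turán coloring -/

open SimpleGraph in
/-- The edge coloring in which the edges of the Turán graph get pairwise different colors and each
part gets one further color. -/
noncomputable def turanLabeling (n s : ℕ) (hs : 0 < s) :
    TopEdgeLabeling (Fin n) ((turanGraph n s).edgeSet ⊕ Fin s) :=
  open Classical in
  EdgeLabeling.mk
    (fun x y _ => if h : (turanGraph n s).Adj x y then Sum.inl ⟨s(x, y), h⟩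
      else Sum.inr ⟨x % s, Nat.mod_lt _ hs⟩)
    (by
      intro x y hxy
      by_cases h : (turanGraph n s).Adj x y
      · simp [h, h.symm, Sym2.eq_swap]
      · have h' : ¬ (turanGraph n s).Adj y x := fun e => h e.symm
        have hm : (x : ℕ) % s = y % s := by simpa [turanGraph_adj] using h
        simp [h, h', hm])

open SimpleGraph in
theorem extremalNumber_add_le_piercingNumber {n p q s : ℕ} (hs : 1 ≤ s) (hq : 3 ≤ q)
    (hp : s * (q - 1) < p) (hn : p ≤ n) :
    extremalNumber n (⊤ : SimpleGraph (Fin (s + 1))) + s ≤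
      piercingNumber n (⊤ : SimpleGraph (Fin p)) (upFamily (⊤ : SimpleGraph (Fin q))) := by
  classical
  have : Nontrivial (Fin (s + 1)) := Fin.nontrivial_iff_two_le.2 (by omega)
  rw [extremalNumber_top, Fintype.card_fin, Nat.add_sub_cancel]
  have hcard : Fintype.card ((turanGraph n s).edgeSet ⊕ Fin s) =
      (turanGraph n s).edgeFinset.card + s := by
    rw [Fintype.card_sum, Fintype.card_fin, edgeFinset_card]
  -- Gives `2 * s < n`, so each residue class contains two vertices `i` and `i + s` and its extra
  -- color is really used.
  have h2s : 2 * s ≤ s * (q - 1) := by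
    rw [mul_comm]
    exact Nat.mul_le_mul_left _ (by omega)
  refine le_piercingNumber (mem_piercingCounts_of_surjective (Fintype.equivFinOfCardEq hcard)
    (turanLabeling n s hs) ?_ ?_)
  · rintro (⟨e, he⟩ | i)
    · induction e using Sym2.inductionOn with
      | hf x y =>
        refine ⟨⟨s(x, y), (mem_edgeSet _).1 he |>.ne⟩, ?_⟩
        exact dif_pos ((mem_edgeSet _).1 he)
    · have hne : (⟨i, by omega⟩ : Fin n) ≠ ⟨i + s, by omega⟩ := by
        simp only [ne_eq, Fin.mk.injEq]
        omega
      refine ⟨⟨s(⟨i, by omega⟩, ⟨i + s, by omega⟩), hne⟩, ?_⟩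
      refine (dif_neg ?_).trans ?_
      · simp [turanGraph_adj]
      · simp [Nat.mod_eq_of_lt i.2]
  · rintro K ⟨φ⟩
    let g : Fin p → Fin s := fun x => ⟨(φ x : Fin n) % s, Nat.mod_lt _ hs⟩
    obtain ⟨c, hc⟩ := Fintype.exists_lt_card_fiber_of_mul_lt_card (f := g) (n := q - 1)
      (by simpa using hp)
    obtain ⟨T, hT, hTc⟩ := Finset.exists_subset_card_eq (Nat.le_of_pred_lt hc)
    let ψ : Fin q ≃ T := (Fintype.equivFinOfCardEq (by simpa using hTc)).symm
    refine ⟨Sum.inr c, top_isContained_colorClass (by omega) _ _ _ ?_⟩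
    have hinj : Function.Injective fun i => ((φ (ψ i : Fin p) : K.verts) : Fin n) :=
      fun i j hij => ψ.injective (Subtype.ext (φ.injective (Subtype.ext hij)))
    have hg : ∀ i, ((φ (ψ i : Fin p) : Fin n) : ℕ) % s = c := fun i => by
      have := (Finset.mem_filter.1 (hT (ψ i).2)).2
      exact congrArg Fin.val this
    refine ⟨⟨⟨fun i => φ (ψ i : Fin p), fun {i j} hij => ?_⟩, hinj⟩⟩
    have hij' : i ≠ j := by simpa using hij
    have hne := hinj.ne hij'
    refine ⟨?_, ?_⟩
    · have : K.coe.Adj (φ (ψ i : Fin p)) (φ (ψ j : Fin p)) :=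
        φ.map_adj_iff.2 (by simpa [Subtype.val_inj] using hij')
      simp at this
      simpa using this
    · rw [TopEdgeLabeling.labelGraph_adj]
      refine ⟨hne, ?_⟩
      refine (dif_neg ?_).trans ?_
      · simp [turanGraph_adj, hg]
      · simp [hg]

/-! ### Upper bound: a rainbow multipartite graph -/

open SimpleGraph in
theorem piercingNumber_le_extremalNumber {V : Type*} [Fintype V] {H : SimpleGraph V}
    (hH : H.Connected) {p q r P : ℕ} [hP : Fact P.Prime] (hq : 3 ≤ q) (hV : Fintype.card V = q)
    (hr0 : 0 < r) (hpr : p ≤ r * (q - 1)) (hrP : r * Fintype.card (Fin (q - 1) × Fin (q - 1) × Bool) < P)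
    (n : ℕ) :
    piercingNumber n (⊤ : SimpleGraph (Fin p)) (upFamily H) ≤
      extremalNumber n (completeEquipartiteGraph r (P * (q - 1))) := by
  classical
  refine piercingNumber_le ?_
  rintro m ⟨C, hC, hpierce⟩
  by_contra! hlt
  -- a rainbow graph with one edge of every color
  choose σ hσ using hC
  have hσi : Function.Injective fun c => (σ c : Sym2 (Fin n)) := fun c d h => by
    rw [← hσ c, ← hσ d, Subtype.ext h]
  let R : SimpleGraph (Fin n) := fromEdgeSet (Set.range fun c => (σ c : Sym2 (Fin n)))
  have hRadj : ∀ x y, R.Adj x y ↔ ∃ c, (σ c : Sym2 (Fin n)) = s(x, y) := by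
    intro x y
    simp only [R, fromEdgeSet_adj, Set.mem_range]
    refine ⟨fun h => h.1, fun ⟨c, hc⟩ => ⟨⟨c, hc⟩, ?_⟩⟩
    have := (σ c).2
    rw [hc, mem_edgeSet] at this
    exact this.ne
  have hRe : R.edgeFinset = Finset.univ.image fun c => (σ c : Sym2 (Fin n)) := by
    ext e
    induction e using Sym2.inductionOn with
    | hf x y => simp [hRadj]
  have hRc : R.edgeFinset.card = m := by
    rw [hRe, Finset.card_image_of_injective _ hσi, Finset.card_univ, Fintype.card_fin]
  obtain ⟨f⟩ : (completeEquipartiteGraph r (P * (q - 1))).IsContained R :=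
    IsContained.of_extremalNumber_lt_card_edgeFinset (by
      rw [Fintype.card_fin]
      exact hlt.trans_le (by convert! hRc.ge))
  -- the vertices, in blocks
  let ι : ZMod P × Fin (q - 1) ≃ Fin (P * (q - 1)) := Fintype.equivFinOfCardEq (by simp)
  let v : Fin r × ZMod P × Fin (q - 1) → Fin n := fun x => f (x.1, ι x.2)
  have hv : Function.Injective v := fun x y h => by
    have h1 := f.injective h
    simp only [Prod.mk.injEq, ι.injective.eq_iff] at h1
    exact Prod.ext h1.1 h1.2
  have hcross : ∀ x y : Fin r × ZMod P × Fin (q - 1), x.1 ≠ y.1 → R.Adj (v x) (v y) :=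
    fun x y h => f.toHom.map_adj h
  -- Edges between parts lie in `R`, so each is the chosen representative of its own color.
  have hcol : ∀ x y : Fin r × ZMod P × Fin (q - 1), x.1 ≠ y.1 → ∀ h c, C.get (v x) (v y) h = c →
      (σ c : Sym2 (Fin n)) = s(v x, v y) := by
    rintro x y hxy h c rfl
    obtain ⟨d, hd⟩ := (hRadj _ _).1 (hcross x y hxy)
    have : C.get (v x) (v y) h = d := by
      rw [← hσ d, EdgeLabeling.get_eq]
      exact congrArg C (Subtype.ext hd.symm)
    rw [this, hd]
  have hrP' : r ≤ P := by
    have : 0 < Fintype.card (Fin (q - 1) × Fin (q - 1) × Bool) := by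
      simp
      omega
    nlinarith
  have : Nonempty (Fin r × ZMod P × Fin (q - 1)) := ⟨⟨0, hr0⟩, 0, ⟨0, by omega⟩⟩
  -- Vertices outside the blocks get an arbitrary value, which can only forbid more choices.
  let blk : Fin n → Fin r × ZMod P := fun z =>
    ((Function.invFun v z).1, (Function.invFun v z).2.1)
  have hblk : ∀ x, blk (v x) = (x.1, x.2.1) := fun x => by
    simp only [blk, Function.leftInverse_invFun hv x]
  -- A pair inside a block conflicts only with blocks meeting the representative of its color; the
  -- Boolean selects an end of that edge. The default `(i, k)` is harmless, since only targets in
  -- other parts matter.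
  let bad : Fin r → ZMod P → Fin (q - 1) × Fin (q - 1) × Bool → Fin r × ZMod P :=
    fun i k δ =>
      if h : v (i, k, δ.1) ≠ v (i, k, δ.2.1) then
        let e := (σ (C.get _ _ h) : Sym2 (Fin n))
        blk (if δ.2.2 then e.out.1 else e.out.2)
      else (i, k)
  obtain ⟨k, hk⟩ := exists_choice_avoiding hrP' hrP bad
  -- inside colors of the chosen blocks do not occur between them
  have hgood : ∀ (i : Fin r) (a b : Fin (q - 1)) (j l : Fin r) (a' b' : Fin (q - 1)) h h',
      j ≠ l → C.get (v (i, k i, a)) (v (i, k i, b)) h ≠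
        C.get (v (j, k j, a')) (v (l, k l, b')) h' := by
    have key : ∀ (i : Fin r) (a b : Fin (q - 1)) (j l : Fin r) (a' b' : Fin (q - 1)) h h',
        j ≠ l → j ≠ i → C.get (v (i, k i, a)) (v (i, k i, b)) h ≠
          C.get (v (j, k j, a')) (v (l, k l, b')) h' := by
      intro i a b j l a' b' h h' hjl hji heq
      have hs := hcol (j, k j, a') (l, k l, b') hjl h' _ heq.symm
      have hmem : v (j, k j, a') ∈ (σ (C.get _ _ h) : Sym2 (Fin n)) := by
        rw [hs]
        exact Sym2.mem_mk_left _ _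
      have hout : ∃ t : Bool, (if t then (σ (C.get _ _ h) : Sym2 (Fin n)).out.1
          else (σ (C.get _ _ h) : Sym2 (Fin n)).out.2) = v (j, k j, a') := by
        rw [← Quot.out_eq (σ (C.get _ _ h) : Sym2 (Fin n))] at hmem
        rcases Sym2.mem_iff.1 hmem with h1 | h1
        · exact ⟨true, h1.symm⟩
        · exact ⟨false, h1.symm⟩
      obtain ⟨t, ht⟩ := hout
      apply hk i (a, b, t) j hji
      simp only [bad]
      rw [dif_pos (show v (i, k i, a) ≠ v (i, k i, b) from h), ht, hblk]
    -- At least one of `j` and `l` differs from `i`, and `key` applies to that end.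
    intro i a b j l a' b' h h' hjl
    by_cases hji : j = i
    · have hli : l ≠ i := fun e => hjl (hji.trans e.symm)
      rw [EdgeLabeling.get_comm (v (l, k l, b')) (v (j, k j, a'))]
      exact key i a b l j b' a' h _ hjl.symm hli
    · exact key i a b j l a' b' h h' hjl hji
  -- a copy of `K_p` on the chosen blocks
  let w : Fin r × Fin (q - 1) → Fin n := fun x => v (x.1, k x.1, x.2)
  have hw : Function.Injective w := fun x y h => by
    have h1 := hv h
    simp only [Prod.mk.injEq] at h1
    exact Prod.ext h1.1 h1.2.2
  obtain ⟨g⟩ : Nonempty (Fin p ↪ Fin r × Fin (q - 1)) := by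
    apply Function.Embedding.nonempty_of_card_le
    simpa using hpr
  let K : (⊤ : SimpleGraph (Fin n)).Subgraph := (⊤ : Subgraph _).induce (Set.range (w ∘ g))
  have hKiso : Nonempty ((⊤ : SimpleGraph (Fin p)) ≃g K.coe) := by
    refine ⟨⟨Equiv.ofInjective (w ∘ g) (hw.comp g.injective), ?_⟩⟩
    intro a b
    change K.Adj (w (g a)) (w (g b)) ↔ _
    simp [K, hw.eq_iff]
  obtain ⟨c, -, ⟨φ⟩⟩ := hpierce K hKiso
  let ψ : V → Fin n := fun x => (φ x : Fin n)
  have hψi : Function.Injective ψ := fun x y h => φ.injective (Subtype.ext h)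
  have hψa : ∀ x y, H.Adj x y → (colorPart C K c).Adj (ψ x) (ψ y) := fun x y h =>
    φ.toHom.map_adj h
  have hψw : ∀ x, ∃ y, w y = ψ x := fun x => by
    obtain ⟨z, hz⟩ := (φ x).2
    have hz' : K.Adj (ψ x) z := by simpa [colorPart, ψ] using hz.1
    obtain ⟨y, hy⟩ := K.edge_vert hz'
    exact ⟨g y, hy⟩
  choose θ hθ using hψw
  have hθi : Function.Injective θ := fun x y h => hψi (by rw [← hθ, ← hθ, h])
  have hθc : ∀ x y, H.Adj x y → ∃ h, C.get (w (θ x)) (w (θ y)) h = c := fun x y h => by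
    have := (hψa x y h).2
    rw [← hθ, ← hθ, TopEdgeLabeling.labelGraph_adj] at this
    exact this
  -- One block has only `q - 1` vertices, too few for `H`.
  obtain ⟨x₀, y₀, h₀⟩ : ∃ x y, (θ x).1 ≠ (θ y).1 := by
    by_contra! hcon
    have : Function.Injective fun x => (θ x).2 := fun x y h => hθi (Prod.ext (hcon x y) h)
    have := Fintype.card_le_of_injective _ this
    rw [hV, Fintype.card_fin] at this
    omega
  obtain ⟨x, y, hxy, hne⟩ := hH.exists_adj_ne (fun x => (θ x).1) h₀
  obtain ⟨x', y', hxy', -, hy1, hy2⟩ := hH.exists_adj_edge_ne (by omega) x y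
  obtain ⟨h1, hc1⟩ := hθc x y hxy
  obtain ⟨h2, hc2⟩ := hθc x' y' hxy'
  -- A second edge inside a block contradicts `hgood`; one between blocks would have to be the same
  -- representative as the first edge, although `y'` is not on that edge.
  by_cases hpart : (θ x').1 = (θ y').1
  · have e2 : w (θ y') = v ((θ x').1, k (θ x').1, (θ y').2) := by simp only [w, hpart]
    have h2' : v ((θ x').1, k (θ x').1, (θ x').2) ≠ v ((θ x').1, k (θ x').1, (θ y').2) := by
      rw [← e2]
      exact h2
    refine hgood (θ x').1 (θ x').2 (θ y').2 (θ x).1 (θ y).1 (θ x).2 (θ y).2 h2' h1 hne ?_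
    refine Eq.trans ?_ (hc2.trans hc1.symm)
    simp only [← e2]
    rfl
  · have e1 := hcol _ _ hne h1 c hc1
    have e2 := hcol _ _ hpart h2 c hc2
    rw [e1] at e2
    have hmem : w (θ y') ∈ s(w (θ x), w (θ y)) := by
      change w (θ y') ∈ s(v _, v _)
      rw [e2]
      exact Sym2.mem_mk_right _ _
    rcases Sym2.mem_iff.1 hmem with h | h
    · exact hy1 (hθi (hw h))
    · exact hy2 (hθi (hw h))

/-! ### Asymptotics and the main theorem -/

open SimpleGraph in
theorem extremalNumber_top_pos {n s : ℕ} (hs : 2 ≤ s) (hn : 2 ≤ n) :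
    0 < extremalNumber n (⊤ : SimpleGraph (Fin (s + 1))) := by
  classical
  have : Nontrivial (Fin (s + 1)) := Fin.nontrivial_iff_two_le.2 (by omega)
  rw [extremalNumber_top, Fintype.card_fin, Nat.add_sub_cancel, Finset.card_pos]
  refine ⟨s(⟨0, by omega⟩, ⟨1, by omega⟩), ?_⟩
  rw [mem_edgeFinset, mem_edgeSet, turanGraph_adj]
  simp [Nat.mod_eq_of_lt hs]

open SimpleGraph in
theorem isEquivalent_piercingNumber {V : Type*} [Fintype V] {H : SimpleGraph V}
    (hH : H.Connected) {p q s : ℕ} (hq : 3 ≤ q) (hV : Fintype.card V = q) (hs : 2 ≤ s)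
    (hp : s * (q - 1) < p) (hp' : p ≤ (s + 1) * (q - 1)) :
    Asymptotics.IsEquivalent Filter.atTop
      (fun n : ℕ => (piercingNumber n (⊤ : SimpleGraph (Fin p)) (upFamily H) : ℝ))
      (fun n : ℕ => (extremalNumber n (⊤ : SimpleGraph (Fin (s + 1))) : ℝ)) := by
  -- `P` depends only on `q` and `s`, so the part size `P * (q - 1)` stays fixed as `n` grows.
  obtain ⟨P, hP, hPp⟩ := Nat.exists_infinite_primes
    ((s + 1) * Fintype.card (Fin (q - 1) × Fin (q - 1) × Bool) + 1)
  have : Fact P.Prime := ⟨hPp⟩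
  have hK : H.IsContained (⊤ : SimpleGraph (Fin q)) :=
    isContained_top_iff.2 ⟨(Fintype.equivFinOfCardEq hV).toEmbedding⟩
  refine Asymptotics.isLittleO_iff.2 fun η hη => ?_
  have ht : 1 ≤ P * (q - 1) := Nat.mul_pos hPp.pos (by omega)
  filter_upwards [eventually_extremalNumber_completeEquipartiteGraph_le hη hs ht,
    Filter.eventually_ge_atTop p] with n hn hpn
  have h1 : (extremalNumber n (⊤ : SimpleGraph (Fin (s + 1))) : ℝ) ≤
      piercingNumber n (⊤ : SimpleGraph (Fin p)) (upFamily H) := by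
    exact_mod_cast (Nat.le_add_right _ s).trans
      ((extremalNumber_add_le_piercingNumber (by omega) hq hp hpn).trans
        (piercingNumber_mono _ hK))
  have h2 : (piercingNumber n (⊤ : SimpleGraph (Fin p)) (upFamily H) : ℝ) ≤
      extremalNumber n (completeEquipartiteGraph (s + 1) (P * (q - 1))) := by
    exact_mod_cast piercingNumber_le_extremalNumber hH hq hV (by omega) hp' (by omega) n
  rw [Pi.sub_apply, Real.norm_of_nonneg (sub_nonneg.2 h1), Real.norm_of_nonneg (Nat.cast_nonneg _)]
  linarith

/-- The hypothesis on `p` amounts to `2 * (q - 1) < p`, hence `r ≥ 3`; this makes the Turán number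
quadratic, so it dominates the error terms. -/
theorem ceil_div_sub_one_bounds {p q r : ℕ} (hq : 3 ≤ q) (hpq : 2 * q - 1 ≤ p)
    (hr : r = ⌈(p : ℚ) / ((q : ℚ) - 1)⌉₊) :
    ∃ s, r = s + 1 ∧ 2 ≤ s ∧ s * (q - 1) < p ∧ p ≤ (s + 1) * (q - 1) := by
  have hq1 : ((q : ℚ) - 1) = ((q - 1 : ℕ) : ℚ) := by
    rw [Nat.cast_sub (by omega), Nat.cast_one]
  have hpos : (0 : ℚ) < ((q - 1 : ℕ) : ℚ) := by
    exact_mod_cast (by omega : 0 < q - 1)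
  rw [hq1] at hr
  have hlt : ∀ a : ℕ, a < r ↔ a * (q - 1) < p := fun a => by
    rw [hr, Nat.lt_ceil, lt_div_iff₀ hpos]
    exact_mod_cast Iff.rfl
  have h2 : 2 < r := (hlt 2).2 (by omega)
  refine ⟨r - 1, by omega, by omega, (hlt _).1 (by omega), ?_⟩
  rw [Nat.sub_add_cancel (by omega)]
  exact not_lt.1 fun h => lt_irrefl r ((hlt r).2 h)

theorem theoremt (p q r : ℕ) (hq : 3 ≤ q) (hpq : 2 * q - 1 ≤ p)
    (hr : r = ⌈(p : ℚ) / ((q : ℚ) - 1)⌉₊) :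
    (∀ {V : Type*} [Fintype V] (H : SimpleGraph V), Fintype.card V = q → H.Connected →
      (∀ n : ℕ, p ≤ n →
        SimpleGraph.extremalNumber n (⊤ : SimpleGraph (Fin r)) + r - 1 ≤
            piercingNumber n (⊤ : SimpleGraph (Fin p)) (upFamily (⊤ : SimpleGraph (Fin q))) ∧
          piercingNumber n (⊤ : SimpleGraph (Fin p)) (upFamily (⊤ : SimpleGraph (Fin q))) ≤
            piercingNumber n (⊤ : SimpleGraph (Fin p)) (upFamily H)) ∧
      ∃ ε : ℕ → ℝ, Filter.Tendsto ε Filter.atTop (nhds 0) ∧ ∀ n : ℕ, p ≤ n →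
        (piercingNumber n (⊤ : SimpleGraph (Fin p)) (upFamily H) : ℝ) ≤
          (1 + ε n) * (SimpleGraph.extremalNumber n (⊤ : SimpleGraph (Fin r)) : ℝ)) ∧
    Asymptotics.IsEquivalent Filter.atTop
      (fun n : ℕ => (piercingNumber n (⊤ : SimpleGraph (Fin p))
        (upFamily (SimpleGraph.pathGraph q)) : ℝ))
      (fun n : ℕ => (SimpleGraph.extremalNumber n (⊤ : SimpleGraph (Fin r)) : ℝ)) ∧
    Asymptotics.IsEquivalent Filter.atTop
      (fun n : ℕ => (piercingNumber n (⊤ : SimpleGraph (Fin p))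
        (upFamily (SimpleGraph.cycleGraph q)) : ℝ))
      (fun n : ℕ => (SimpleGraph.extremalNumber n (⊤ : SimpleGraph (Fin r)) : ℝ)) := by
  obtain ⟨s, rfl, hs, hp, hp'⟩ := ceil_div_sub_one_bounds hq hpq hr
  refine ⟨fun {V} _ H hV hH => ⟨fun n hn => ⟨?_, ?_⟩, ?_⟩, ?_, ?_⟩
  · exact extremalNumber_add_le_piercingNumber (by omega) hq hp hn
  · exact piercingNumber_mono _
      (SimpleGraph.isContained_top_iff.2 ⟨(Fintype.equivFinOfCardEq hV).toEmbedding⟩)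
  · have hpos : ∀ n, p ≤ n →
        (0 : ℝ) < SimpleGraph.extremalNumber n (⊤ : SimpleGraph (Fin (s + 1))) := fun n hn => by
      exact_mod_cast extremalNumber_top_pos hs (by omega)
    have hz := (Filter.eventually_ge_atTop p).mono fun n hn => (hpos n hn).ne'
    have ht := (Asymptotics.isEquivalent_iff_tendsto_one hz).1
      (isEquivalent_piercingNumber hH hq hV hs hp hp')
    -- Taking `ε` to be the exact relative excess makes the bound an equality for every `n ≥ p`, as
    -- the Turán number is positive there.
    refine ⟨fun n => (piercingNumber n (⊤ : SimpleGraph (Fin p)) (upFamily H) : ℝ) /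
      SimpleGraph.extremalNumber n (⊤ : SimpleGraph (Fin (s + 1))) - 1, ?_, fun n hn => ?_⟩
    · simpa using ht.sub_const 1
    · rw [add_sub_cancel, div_mul_cancel₀ _ (hpos n hn).ne']
  · obtain ⟨k, rfl⟩ : ∃ k, q = k + 1 := ⟨q - 1, by omega⟩
    exact isEquivalent_piercingNumber (SimpleGraph.pathGraph_connected k) hq (by simp) hs hp hp'
  · obtain ⟨k, rfl⟩ : ∃ k, q = k + 1 := ⟨q - 1, by omega⟩
    exact isEquivalent_piercingNumber SimpleGraph.cycleGraph_connected hq (by simp) hs hp hp'
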